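/- Let $c_0,c_1,c_2,\dots$ be formal power series over $\mathbb{Q}$ in a set of indeterminates $x=(x_i)_{i\in\sigma}$, each without constant term and such that every monomial in $x$ occurs in only finitely many of the $c_a$ (for example, the $c_a$ are themselves independent indeterminates, or almost all $c_a$ are zero). Put $P(X)=\sum_{a\ge 0}c_aX^a$ and $A(v,y)=v^{-1}P\bigl(v(1+y)^2\bigr)\in\mathbb{Q}[v^{\pm1},y^{\pm1}][[x]]$, and define $$T(v,y)=y+\sum_{r\ge 1}\frac{1}{r!}\Bigl(\frac1y\frac{d}{dy}\Bigr)^{r-1}\Bigl(\frac{1+y}{y}\,A(v,y)^r\Bigr)\in\mathbb{Q}[v^{\pm1},y^{\pm1}][[x]].$$ Then $\frac{T(v,y)+y}{2}$ is invertible in $\mathbb{Q}[v^{\pm1},y^{\pm1}][[x]]$, and for every integer $N\ge 1$ one has, in $\mathbb{Q}[[x]]$, $$\bigl[v^{N-1}y^{-2}\bigr]\Bigl(\frac{T(v,y)+y}{2}\Bigr)^{-N}=-\frac14\,N\binom{2N+2}{N+1}\,c_N ,$$ where $[v^iy^j]$ denotes the coefficient of $v^iy^j$, taken separately for each monomial in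 $x$. -/

import Mathlib

noncomputable section

namespace CuriousIdentity

/-- The ring `ℚ[v^{±1}, y^{±1}]` of Laurent polynomials in `v` and `y`: the monomial `v^i y^j`
has exponent `(i, j) : ℤ × ℤ`. -/
abbrev Laurent : Type := AddMonoidAlgebra ℚ (ℤ × ℤ)

/-- The Laurent monomial `v^i y^j`. -/
def mono (i j : ℤ) : Laurent := AddMonoidAlgebra.single (i, j) 1

/-- The variable `v`. -/
def v : Laurent := mono 1 0

/-- The inverse `v⁻¹` of `v`. -/
def vInv : Laurent := mono (-1) 0

/-- The variable `y`. -/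
def y : Laurent := mono 0 1

/-- The inverse `y⁻¹` of `y`. -/
def yInv : Laurent := mono 0 (-1)

/-- The derivative `d/dy`: it sends `q v^i y^j` to `j q v^i y^{j-1}`. -/
def ddy (f : Laurent) : Laurent :=
  f.coeff.sum fun p q => AddMonoidAlgebra.single (p.1, p.2 - 1) ((p.2 : ℚ) * q)

variable {σ : Type*}

/-- The operator `(1/y) d/dy` on `ℚ[v^{±1}, y^{±1}]⟦x_i : i ∈ σ⟧`, which acts on the coefficients. -/
def yInvDdy (F : MvPowerSeries σ Laurent) : MvPowerSeries σ Laurent :=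
  fun m => yInv * ddy (MvPowerSeries.coeff m F)

/-- For `P(X) = ∑_{a ≥ 0} c_a X^a` with coefficients `c_a ∈ ℚ⟦x_i : i ∈ σ⟧`, the series
`A(v, y) = v⁻¹ P(v (1 + y)²)`. Its coefficient at a monomial in the `x_i` is a finite sum as soon as
that monomial occurs in only finitely many of the `c_a`. -/
def A (c : ℕ → MvPowerSeries σ ℚ) : MvPowerSeries σ Laurent :=
  fun m => vInv * ∑ᶠ a : ℕ, MvPowerSeries.coeff m (c a) • (v * (1 + y) ^ 2) ^ a

/-- The term `(1/r!) ((1/y) d/dy)^{r-1} (((1 + y)/y) A(v, y)^r)`, for `r ≥ 1`. -/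
def term (c : ℕ → MvPowerSeries σ ℚ) (r : ℕ) : MvPowerSeries σ Laurent :=
  ((r.factorial : ℚ)⁻¹) • yInvDdy^[r - 1] (MvPowerSeries.C ((1 + y) * yInv) * A c ^ r)

/-- The series `T(v, y) = y + ∑_{r ≥ 1} (1/r!) ((1/y) d/dy)^{r-1} (((1 + y)/y) A(v, y)^r)`.
When the `c_a` have no constant term, the terms with `r > deg m` do not contribute to the coefficient
at the monomial `m` (`coeff_term_eq_zero` below), so they are left out here. -/
def T (c : ℕ → MvPowerSeries σ ℚ) : MvPowerSeries σ Laurent :=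
  fun m => MvPowerSeries.coeff m (MvPowerSeries.C y) +
    ∑ r ∈ Finset.Icc 1 m.degree, MvPowerSeries.coeff m (term c r)

/-- The coefficient `[v^i y^j] F ∈ ℚ⟦x_i⟧` of a series `F` over the Laurent polynomials. -/
def coeffVY (i j : ℤ) (F : MvPowerSeries σ Laurent) : MvPowerSeries σ ℚ :=
  fun m => (MvPowerSeries.coeff m F).coeff (i, j)

theorem coeff_iterate_yInvDdy (F : MvPowerSeries σ Laurent) (n : ℕ) (m : σ →₀ ℕ)
    (h : MvPowerSeries.coeff m F = 0) : MvPowerSeries.coeff m (yInvDdy^[n] F) = 0 := by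
  induction n with
  | zero => simpa using h
  | succ n ih =>
    rw [Function.iterate_succ_apply']
    change yInv * ddy (MvPowerSeries.coeff m (yInvDdy^[n] F)) = 0
    rw [ih]
    simp [ddy]

theorem coeff_term_eq_zero (c : ℕ → MvPowerSeries σ ℚ)
    (h0 : ∀ a, MvPowerSeries.constantCoeff (c a) = 0) (r : ℕ) (m : σ →₀ ℕ) (hr : m.degree < r) :
    MvPowerSeries.coeff m (term c r) = 0 := by
  have hA : MvPowerSeries.constantCoeff (A c) = 0 := by
    change vInv * ∑ᶠ a : ℕ, MvPowerSeries.constantCoeff (c a) • (v * (1 + y) ^ 2) ^ a = 0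
    simp [h0]
  have hp : MvPowerSeries.coeff m (A c ^ r) = 0 := by
    apply MvPowerSeries.coeff_of_lt_order
    have h1 : (1 : ℕ∞) ≤ (A c).order := MvPowerSeries.one_le_order_iff_constCoeff_eq_zero.2 hA
    have h2 := MvPowerSeries.le_order_pow (f := A c) r
    refine lt_of_lt_of_le ?_ h2
    calc (m.degree : ℕ∞) < (r : ℕ∞) := by exact_mod_cast hr
      _ = r • (1 : ℕ∞) := by simp
      _ ≤ r • (A c).order := by gcongr
  change ((r.factorial : ℚ)⁻¹) • MvPowerSeries.coeff m
    (yInvDdy^[r - 1] (MvPowerSeries.C ((1 + y) * yInv) * A c ^ r)) = 0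
  rw [coeff_iterate_yInvDdy, smul_zero]
  rw [MvPowerSeries.coeff_C_mul, hp, mul_zero]

end CuriousIdentity

end

/-! Put `D = (1/y) d/dy`, which is `d/dt` for `t = y²/2`. Since `D (y + y²/2) = (1 + y)/y`, the sum
defining `T` is a Lagrange series: the Taylor shift `S : t ↦ t - A` sends `y + y²/2 + (T - y)` back
to `y + y²/2` (`shiftHom_lagrange`). As `S y = √(y² - 2A)`, this gives `S ((T + y)/2) = u(A)` with
`u(s) = (y + √(y² - 2s) + s)/2` (`shiftHom_T`).

The coefficient of `y⁻²` is the residue in `t`: it kills the image of `D`. By change of variables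
(`res_coeff_shiftHom`) the required coefficient is the residue of `(1 - D A) u(A)^{-N}`. Integration
by parts turns this into a sum over `r` of residues of `A^{r+1}` times `[s^r] (∂s + D) u^{-N} / (r +
1)`. Because `∂s + D` kills `√(y² - 2s)`, that factor is `-N (1 + y⁻¹) / (2(r + 1))` times `[s^r]
u^{-N-1}`.

As `A^{r+1}` is `v^{-r-1}` times a polynomial in `v (1 + y)²`, extracting `v^{N-1}` leaves a scalar
times `[y⁻¹] (1 + y)^{2N+2r+1} [s^r] u^{-N-1}`. A differential equation for `u` makes this vanish
for `r ≥ 1` (`resUInv_eq_zero`). Only `r = 0` survives; it is linear in the `c_a` and yields a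
binomial coefficient times `c_N`. -/

noncomputable section

namespace CuriousIdentity

open Finset

/-! ### Derivations acting on coefficients. -/

section Coefficientwise

variable {k R : Type*} [CommRing k] [CommRing R] [Algebra k R] {τ : Type*}

/-- A derivation of `R`, applied to each coefficient of a power series over `R`. -/
def mapDerivation (d : Derivation k R R) :
    Derivation k (MvPowerSeries τ R) (MvPowerSeries τ R) :=
  Derivation.mk'
    { toFun := fun F m => d (MvPowerSeries.coeff m F)
      map_add' := fun F G => by
        ext m
        change d (MvPowerSeries.coeff m (F + G)) =
          d (MvPowerSeries.coeff m F) + d (MvPowerSeries.coeff m G)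
        simp
      map_smul' := fun q F => by
        ext m
        change d (q • MvPowerSeries.coeff m F) = q • d (MvPowerSeries.coeff m F)
        simp }
    fun F G => by
      classical
      ext m
      change d (MvPowerSeries.coeff m (F * G)) = _
      rw [MvPowerSeries.coeff_mul, map_sum, smul_eq_mul, smul_eq_mul, map_add,
        MvPowerSeries.coeff_mul, mul_comm G, MvPowerSeries.coeff_mul, ← sum_add_distrib]
      refine sum_congr rfl fun p _ => ?_
      rw [d.leibniz, smul_eq_mul, smul_eq_mul, mul_comm (MvPowerSeries.coeff p.2 G)]
      rfl

theorem coeff_mapDerivation (d : Derivation k R R) (m : τ →₀ ℕ) (F : MvPowerSeries τ R) :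
    MvPowerSeries.coeff m (mapDerivation d F) = d (MvPowerSeries.coeff m F) := rfl

theorem coeff_mapDerivation_powerSeries (d : Derivation k R R) (n : ℕ) (F : PowerSeries R) :
    PowerSeries.coeff n (mapDerivation d F : PowerSeries R) = d (PowerSeries.coeff n F) := rfl

theorem mapDerivation_C (d : Derivation k R R) (f : R) :
    mapDerivation d (MvPowerSeries.C f : MvPowerSeries τ R) = MvPowerSeries.C (d f) := by
  classical
  ext m
  rw [coeff_mapDerivation, MvPowerSeries.coeff_C, MvPowerSeries.coeff_C]
  split_ifs <;> simp

theorem coeff_iterate_mapDerivation (d : Derivation k R R) (n : ℕ) (m : τ →₀ ℕ)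
    (F : MvPowerSeries τ R) :
    MvPowerSeries.coeff m ((mapDerivation d)^[n] F) = d^[n] (MvPowerSeries.coeff m F) := by
  induction n generalizing F with
  | zero => rfl
  | succ n ih => rw [Function.iterate_succ_apply, ih, Function.iterate_succ_apply]; rfl

end Coefficientwise

/-! ### The exponential of a derivation. -/

section Exponential

variable {R : Type*} [CommRing R] [Algebra ℚ R]

theorem iterate_smul (d : Derivation ℚ R R) (n : ℕ) (q : ℚ) (f : R) :
    d^[n] (q • f) = q • d^[n] f := by
  induction n generalizing f with
  | zero => rfl
  | succ n ih => rw [Function.iterate_succ_apply, d.map_smul, ih, Function.iterate_succ_apply]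

theorem iterate_sum (d : Derivation ℚ R R) (n : ℕ) {ι : Type*} (s : Finset ι) (f : ι → R) :
    d^[n] (∑ i ∈ s, f i) = ∑ i ∈ s, d^[n] (f i) :=
  map_sum ({ toFun := d^[n], map_zero' := iterate_map_zero d n,
             map_add' := iterate_map_add d n } : R →+ R) f s

/-- A power series with `(n + 1) F_{n+1} = d F_n` is the exponential of `s d` at its constant
coefficient. -/
theorem coeff_of_succ_smul_coeff_succ (d : Derivation ℚ R R) (F : PowerSeries R)
    (h : ∀ n : ℕ, ((n : ℚ) + 1) • PowerSeries.coeff (n + 1) F = d (PowerSeries.coeff n F)) (n : ℕ) :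
    PowerSeries.coeff n F = (n.factorial : ℚ)⁻¹ • d^[n] (PowerSeries.coeff 0 F) := by
  induction n with
  | zero => simp
  | succ n ih =>
    have h1 : ((n : ℚ) + 1) ≠ 0 := by positivity
    have h2 := h n
    rw [ih, d.map_smul, ← Function.iterate_succ_apply' d] at h2
    rw [← inv_smul_smul₀ h1 (PowerSeries.coeff (n + 1) F), h2, smul_smul, Nat.factorial_succ]
    push_cast
    rw [mul_inv]

/-- The ring homomorphism `f ↦ ∑ dⁿ f / n! · sⁿ` attached to a derivation `d`. -/
def expHom (d : Derivation ℚ R R) : R →+* PowerSeries R where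
  toFun f := PowerSeries.mk fun n => (n.factorial : ℚ)⁻¹ • d^[n] f
  map_zero' := by
    ext n
    simp
  map_one' := by
    ext n
    rw [PowerSeries.coeff_mk, PowerSeries.coeff_one]
    cases n with
    | zero => simp
    | succ n => simp [Function.iterate_succ_apply]
  map_add' f g := by
    ext n
    simp
  map_mul' f g := by
    have key : ∀ (f : R) (n : ℕ), ((n : ℚ) + 1) •
        ((n + 1).factorial : ℚ)⁻¹ • d^[n + 1] f = d ((n.factorial : ℚ)⁻¹ • d^[n] f) := by
      intro f n
      have h1 : ((n : ℚ) + 1) ≠ 0 := by positivity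
      rw [d.map_smul, smul_smul, Function.iterate_succ_apply', Nat.factorial_succ]
      push_cast
      rw [mul_inv, mul_inv_cancel_left₀ h1]
    have key' : ∀ f : R, PowerSeries.derivative R
        (PowerSeries.mk fun n => (n.factorial : ℚ)⁻¹ • d^[n] f) =
        mapDerivation d (PowerSeries.mk fun n => (n.factorial : ℚ)⁻¹ • d^[n] f) := by
      intro f
      ext n
      rw [PowerSeries.coeff_derivative, coeff_mapDerivation_powerSeries, PowerSeries.coeff_mk,
        PowerSeries.coeff_mk, ← key]
      simp [Algebra.smul_def, mul_comm]
    set F : R → PowerSeries R := fun f => PowerSeries.mk fun n => (n.factorial : ℚ)⁻¹ • d^[n] f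
      with hF
    -- By Leibniz the product solves the same equation `∂s = d` as its factors, and a solution is
    -- determined by its constant coefficient, here `f * g`.
    have hFG : PowerSeries.derivative R (F f * F g) = mapDerivation d (F f * F g) := by
      rw [Derivation.leibniz, Derivation.leibniz, key', key']
    ext n
    change PowerSeries.coeff n (F (f * g)) = PowerSeries.coeff n (F f * F g)
    rw [coeff_of_succ_smul_coeff_succ d (F f * F g)]
    · simp [hF]
    · intro n
      rw [← coeff_mapDerivation_powerSeries, ← hFG, PowerSeries.coeff_derivative]
      simp [Algebra.smul_def, mul_comm]

theorem coeff_expHom (d : Derivation ℚ R R) (f : R) (n : ℕ) :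
    PowerSeries.coeff n (expHom d f) = (n.factorial : ℚ)⁻¹ • d^[n] f :=
  PowerSeries.coeff_mk n fun n => (n.factorial : ℚ)⁻¹ • d^[n] f

end Exponential

/-- The square and the triangle differ only by terms with `n ≤ i + j`. In the uses below these
vanish because their order in the variables is too high. -/
theorem sum_range_sum_range_eq_sum_antidiagonal {M : Type*} [AddCommMonoid M] (t : ℕ → ℕ → M)
    (n : ℕ) (h : ∀ i j, n ≤ i + j → t i j = 0) :
    ∑ i ∈ range n, ∑ j ∈ range n, t i j =
      ∑ r ∈ range n, ∑ p ∈ antidiagonal r, t p.1 p.2 := by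
  rw [← sum_product', sum_sigma']
  symm
  refine sum_bij_ne_zero (fun x _ _ => x.2) ?_ ?_ ?_ ?_
  · rintro ⟨r, i, j⟩ hx -
    simp only [mem_sigma, mem_range, HasAntidiagonal.mem_antidiagonal, mem_product] at hx ⊢
    omega
  · rintro ⟨r, i, j⟩ hx - ⟨r', i', j'⟩ hx' - h
    simp only [mem_sigma, mem_range, HasAntidiagonal.mem_antidiagonal] at hx hx'
    obtain ⟨rfl, rfl⟩ := Prod.mk.inj h
    obtain ⟨-, rfl⟩ := hx
    obtain ⟨-, rfl⟩ := hx'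
    rfl
  · rintro ⟨i, j⟩ - hij
    refine ⟨⟨i + j, i, j⟩, ?_, hij, rfl⟩
    simp only [mem_sigma, mem_range, HasAntidiagonal.mem_antidiagonal, and_true]
    by_contra hlt
    exact hij (h i j (by omega))
  · intros
    rfl

/-! ### Substituting a series without constant term. -/

section Evaluation

variable {R : Type*} [CommRing R] {τ : Type*}

theorem coeff_pow_mul_eq_zero {a : MvPowerSeries τ R} (ha : MvPowerSeries.constantCoeff a = 0)
    (b : MvPowerSeries τ R) {r : ℕ} {m : τ →₀ ℕ} (h : m.degree < r) :
    MvPowerSeries.coeff m (a ^ r * b) = 0 := by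
  apply MvPowerSeries.coeff_of_lt_order
  calc (m.degree : ℕ∞) < (r : ℕ∞) := by exact_mod_cast h
    _ ≤ (a ^ r).order := MvPowerSeries.le_order_pow_of_constantCoeff_eq_zero r ha
    _ ≤ (a ^ r).order + b.order := le_self_add
    _ ≤ (a ^ r * b).order := MvPowerSeries.le_order_mul

theorem coeff_mul_congr {F F' G G' : MvPowerSeries τ R} {n : ℕ}
    (hF : ∀ p : τ →₀ ℕ, p.degree < n → MvPowerSeries.coeff p F = MvPowerSeries.coeff p F')
    (hG : ∀ p : τ →₀ ℕ, p.degree < n → MvPowerSeries.coeff p G = MvPowerSeries.coeff p G')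
    {m : τ →₀ ℕ} (hm : m.degree < n) :
    MvPowerSeries.coeff m (F * G) = MvPowerSeries.coeff m (F' * G') := by
  classical
  rw [MvPowerSeries.coeff_mul, MvPowerSeries.coeff_mul]
  refine sum_congr rfl fun p hp => ?_
  have h := congrArg Finsupp.degree (mem_antidiagonal.1 hp)
  rw [map_add] at h
  rw [hF _ (by omega), hG _ (by omega)]

/-- The series `∑ aʳ h_r`, for a power series `a` without constant term. -/
def evalFun (a : MvPowerSeries τ R) (h : PowerSeries (MvPowerSeries τ R)) : MvPowerSeries τ R :=
  fun m => ∑ r ∈ range (m.degree + 1), MvPowerSeries.coeff m (a ^ r * PowerSeries.coeff r h)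

theorem coeff_evalFun {a : MvPowerSeries τ R} (ha : MvPowerSeries.constantCoeff a = 0)
    (h : PowerSeries (MvPowerSeries τ R)) {m : τ →₀ ℕ} {n : ℕ} (hn : m.degree < n) :
    MvPowerSeries.coeff m (evalFun a h) =
      MvPowerSeries.coeff m (∑ r ∈ range n, a ^ r * PowerSeries.coeff r h) := by
  rw [map_sum]
  change ∑ r ∈ range (m.degree + 1), MvPowerSeries.coeff m (a ^ r * PowerSeries.coeff r h) = _
  refine sum_subset (range_subset_range.2 (by omega)) fun r _ hr => ?_
  exact coeff_pow_mul_eq_zero ha _ (by simpa [Nat.lt_succ_iff] using hr)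

/-- Evaluation of a power series at `a`, as a ring homomorphism. -/
def evalAt (a : MvPowerSeries τ R) (ha : MvPowerSeries.constantCoeff a = 0) :
    PowerSeries (MvPowerSeries τ R) →+* MvPowerSeries τ R where
  toFun := evalFun a
  map_zero' := by
    ext m
    rw [coeff_evalFun ha _ m.degree.lt_succ_self]
    simp
  map_one' := by
    ext m
    rw [coeff_evalFun ha _ m.degree.lt_succ_self, sum_range_succ']
    simp [PowerSeries.coeff_one]
  map_add' f g := by
    ext m
    rw [map_add, coeff_evalFun ha _ m.degree.lt_succ_self, coeff_evalFun ha _ m.degree.lt_succ_self,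
      coeff_evalFun ha _ m.degree.lt_succ_self]
    simp [mul_add, sum_add_distrib]
  map_mul' f g := by
    ext m
    set n := m.degree + 1 with hn
    have hm : m.degree < n := m.degree.lt_succ_self
    rw [coeff_mul_congr (fun p hp => coeff_evalFun ha f hp) (fun p hp => coeff_evalFun ha g hp) hm,
      coeff_evalFun ha _ hm, sum_mul_sum]
    simp only [map_sum]
    rw [sum_range_sum_range_eq_sum_antidiagonal]
    · refine sum_congr rfl fun r _ => ?_
      rw [PowerSeries.coeff_mul, mul_sum, map_sum]
      refine sum_congr rfl fun p hp => ?_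
      rw [← HasAntidiagonal.mem_antidiagonal.1 hp]
      ring_nf
    · intro i j hij
      rw [show a ^ i * PowerSeries.coeff i f * (a ^ j * PowerSeries.coeff j g) =
        a ^ (i + j) * (PowerSeries.coeff i f * PowerSeries.coeff j g) by ring]
      exact coeff_pow_mul_eq_zero ha _ (by omega)

theorem coeff_evalAt {a : MvPowerSeries τ R} (ha : MvPowerSeries.constantCoeff a = 0)
    (h : PowerSeries (MvPowerSeries τ R)) {m : τ →₀ ℕ} {n : ℕ} (hn : m.degree < n) :
    MvPowerSeries.coeff m (evalAt a ha h) =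
      MvPowerSeries.coeff m (∑ r ∈ range n, a ^ r * PowerSeries.coeff r h) :=
  coeff_evalFun ha h hn

end Evaluation

/-! ### The commutator identity behind Lagrange inversion. -/

section Lagrange

variable {R : Type*} [CommRing R] [Algebra ℚ R]

/-- An `n`-fold commutator with multiplication by `a` annihilates a differential operator of order
`m < n`. -/
theorem sum_antidiagonal_neg_pow_mul_iterate (d : Derivation ℚ R R) (a : R) (m : ℕ) :
    ∀ (n : ℕ) (_ : m < n) (g : R), ∑ p ∈ antidiagonal n,
      ((p.1.factorial : ℚ)⁻¹ * (p.2.factorial : ℚ)⁻¹) • ((-a) ^ p.1 * d^[m] (a ^ p.2 * g)) = 0 := by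
  induction m with
  | zero =>
    intro n hn g
    -- For `m = 0` the sum is the binomial expansion of `(-a + a)ⁿ g / n!`, which is zero as `n >
    -- 0`.
    have h := (Commute.all (-a) a).add_pow' n
    rw [neg_add_cancel, zero_pow hn.ne'] at h
    have h2 : (n.factorial : ℚ)⁻¹ • ((∑ p ∈ antidiagonal n,
        n.choose p.1 • ((-a) ^ p.1 * a ^ p.2)) * g) = 0 := by
      rw [← h, zero_mul, smul_zero]
    rw [← h2, sum_mul, smul_sum]
    refine sum_congr rfl fun p hp => ?_
    rw [← HasAntidiagonal.mem_antidiagonal.1 hp, Function.iterate_zero, id, ← mul_assoc,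
      ← Nat.cast_smul_eq_nsmul ℚ, smul_mul_assoc, smul_smul]
    congr 1
    rw [Nat.cast_add_choose]
    have := Nat.factorial_ne_zero (p.1 + p.2)
    field_simp
  | succ m ih =>
    intro n hn g
    obtain ⟨n, rfl⟩ : ∃ k, n = k + 1 := ⟨n - 1, by omega⟩
    -- Applying the innermost `d` splits the sum in two, both with `m` derivatives left: one of
    -- degree `n + 1` for `d g`, and one that becomes degree `n` for `d a * g` after reindexing.
    have key : ∀ p : ℕ × ℕ, ((p.1.factorial : ℚ)⁻¹ * (p.2.factorial : ℚ)⁻¹) •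
          ((-a) ^ p.1 * d^[m + 1] (a ^ p.2 * g)) =
        ((p.1.factorial : ℚ)⁻¹ * (p.2.factorial : ℚ)⁻¹) • ((-a) ^ p.1 * d^[m] (a ^ p.2 * d g)) +
        ((p.1.factorial : ℚ)⁻¹ * (p.2.factorial : ℚ)⁻¹) •
          ((-a) ^ p.1 * ((p.2 : ℚ) • d^[m] (a ^ (p.2 - 1) * (d a * g)))) := by
      intro p
      rw [Function.iterate_succ_apply, d.leibniz, d.leibniz_pow, iterate_map_add, mul_add, smul_add,
        ← iterate_smul]
      congr 6
      rw [← Nat.cast_smul_eq_nsmul ℚ]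
      simp only [smul_eq_mul, Algebra.smul_def, map_natCast]
      ring
    rw [sum_congr rfl fun p _ => key p, sum_add_distrib, ih _ (by omega), zero_add,
      Nat.sum_antidiagonal_succ']
    simp only [Nat.cast_zero, zero_smul, mul_zero, smul_zero, zero_add, Nat.add_sub_cancel]
    rw [← ih n (by omega) (d a * g)]
    refine sum_congr rfl fun p _ => ?_
    rw [mul_smul_comm, smul_smul]
    congr 1
    rw [Nat.factorial_succ]
    push_cast
    field_simp

end Lagrange

/-! ### The Taylor shift and Lagrange inversion. -/

section Shift

variable {R : Type*} [CommRing R] [Algebra ℚ R] {τ : Type*}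

theorem coeff_rat_smul (q : ℚ) (F : MvPowerSeries τ R) (m : τ →₀ ℕ) :
    MvPowerSeries.coeff m (q • F) = q • MvPowerSeries.coeff m F := rfl

/-- The ring homomorphism `G ↦ ∑ (-a)ᵏ dᵏ G / k!`, the Taylor shift by `-a`. -/
def shiftHom (d : Derivation ℚ R R) (a : MvPowerSeries τ R)
    (ha : MvPowerSeries.constantCoeff a = 0) : MvPowerSeries τ R →+* MvPowerSeries τ R :=
  (evalAt (-a) (by rw [map_neg, ha, neg_zero])).comp (expHom (mapDerivation d))

variable (d : Derivation ℚ R R) {a : MvPowerSeries τ R}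

theorem coeff_shiftHom (ha : MvPowerSeries.constantCoeff a = 0)
    (G : MvPowerSeries τ R) {m : τ →₀ ℕ} {n : ℕ} (hn : m.degree < n) :
    MvPowerSeries.coeff m (shiftHom d a ha G) =
      MvPowerSeries.coeff m (∑ k ∈ range n,
        (k.factorial : ℚ)⁻¹ • ((-a) ^ k * (mapDerivation d)^[k] G)) := by
  rw [shiftHom, RingHom.comp_apply, coeff_evalAt _ _ hn]
  simp only [coeff_expHom, mul_smul_comm]

/-- The shift never lowers degrees. This allows a series whose cutoff varies with the monomial to be
replaced by a single finite sum. -/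
theorem coeff_shiftHom_congr (ha : MvPowerSeries.constantCoeff a = 0)
    {G G' : MvPowerSeries τ R} {m : τ →₀ ℕ}
    (h : ∀ p : τ →₀ ℕ, p.degree ≤ m.degree →
      MvPowerSeries.coeff p G = MvPowerSeries.coeff p G') :
    MvPowerSeries.coeff m (shiftHom d a ha G) = MvPowerSeries.coeff m (shiftHom d a ha G') := by
  have hn : m.degree < m.degree + 1 := m.degree.lt_succ_self
  rw [coeff_shiftHom d ha G hn, coeff_shiftHom d ha G' hn, map_sum, map_sum]
  refine sum_congr rfl fun k _ => ?_
  rw [← smul_mul_assoc, ← smul_mul_assoc]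
  refine coeff_mul_congr (fun _ _ => rfl) (fun p hp => ?_) hn
  rw [coeff_iterate_mapDerivation, coeff_iterate_mapDerivation, h p (by omega)]

theorem coeff_iterate_mapDerivation_pow_mul_eq_zero (ha : MvPowerSeries.constantCoeff a = 0)
    (j r : ℕ) (g : MvPowerSeries τ R) {m : τ →₀ ℕ} (h : m.degree < r) :
    MvPowerSeries.coeff m ((mapDerivation d)^[j] (a ^ r * g)) = 0 := by
  rw [coeff_iterate_mapDerivation, coeff_pow_mul_eq_zero ha _ h, iterate_map_zero]

theorem coeff_neg_pow_mul_iterate_eq_zero (ha : MvPowerSeries.constantCoeff a = 0)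
    (k j r : ℕ) (g : MvPowerSeries τ R) {m : τ →₀ ℕ} (h : m.degree < k + r) :
    MvPowerSeries.coeff m ((-a) ^ k * (mapDerivation d)^[j] (a ^ r * g)) = 0 := by
  apply MvPowerSeries.coeff_of_lt_order
  calc (m.degree : ℕ∞) < ((k + r : ℕ) : ℕ∞) := by exact_mod_cast h
    _ = k + r := by push_cast; rfl
    _ ≤ ((-a) ^ k).order + ((mapDerivation d)^[j] (a ^ r * g)).order := by
      refine add_le_add (MvPowerSeries.le_order_pow_of_constantCoeff_eq_zero k (by simp [ha]))
        (MvPowerSeries.nat_le_order fun p hp =>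
          coeff_iterate_mapDerivation_pow_mul_eq_zero d ha j r g hp)
    _ ≤ _ := MvPowerSeries.le_order_mul

/-- Lagrange inversion: the Taylor shift by `-a` is inverse to
`F ↦ F + ∑ d^{r-1} (aʳ d F) / r!`. -/
theorem shiftHom_lagrange (ha : MvPowerSeries.constantCoeff a = 0)
    (F L : MvPowerSeries τ R)
    (hL : ∀ m : τ →₀ ℕ, MvPowerSeries.coeff m L = ∑ r ∈ Icc 1 m.degree, MvPowerSeries.coeff m
      ((r.factorial : ℚ)⁻¹ • (mapDerivation d)^[r - 1] (a ^ r * mapDerivation d F))) :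
    shiftHom d a ha (F + L) = F := by
  set D : Derivation ℚ (MvPowerSeries τ R) (MvPowerSeries τ R) := mapDerivation d with hD
  ext m
  set n := m.degree + 1 with hn
  have hm : m.degree < n := m.degree.lt_succ_self
  -- The index `(0, 0)` corresponds to `F` itself, which is kept apart; there `k + r - 1` would
  -- truncate to `0`.
  set t : ℕ → ℕ → R := fun k r => if k + r = 0 then 0 else MvPowerSeries.coeff m
    (((k.factorial : ℚ)⁻¹ * (r.factorial : ℚ)⁻¹) • ((-a) ^ k * D^[k + r - 1] (a ^ r * D F)))
    with ht
  have hLm : MvPowerSeries.coeff m (shiftHom d a ha L) =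
      ∑ k ∈ range n, ∑ r ∈ range m.degree, t k (r + 1) := by
    rw [coeff_shiftHom_congr d ha (G' := ∑ r ∈ range m.degree,
      ((r + 1).factorial : ℚ)⁻¹ • D^[r] (a ^ (r + 1) * D F)), coeff_shiftHom d ha _ hm, map_sum]
    · refine sum_congr rfl fun k _ => ?_
      rw [iterate_sum, mul_sum, smul_sum, map_sum]
      refine sum_congr rfl fun r _ => ?_
      rw [ht, iterate_smul, mul_smul_comm, smul_smul, ← Function.iterate_add_apply]
      rfl
    · intro p hp
      rw [hL, map_sum, ← sum_subset (range_subset_range.2 hp)]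
      · refine sum_nbij' (fun r => r - 1) (fun r => r + 1) ?_ ?_ ?_ ?_ ?_
        · intro r hr
          rw [mem_Icc] at hr
          rw [mem_range]
          omega
        · intro r hr
          rw [mem_range] at hr
          rw [mem_Icc]
          omega
        · intro r hr
          rw [mem_Icc] at hr
          omega
        · intro r _
          rfl
        · intro r hr
          rw [mem_Icc] at hr
          rw [Nat.sub_add_cancel hr.1]
      · intro r _ hr
        rw [mem_range, not_lt] at hr
        rw [coeff_rat_smul, coeff_iterate_mapDerivation_pow_mul_eq_zero d ha _ _ _ (by omega),
          smul_zero]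
  have hFm : MvPowerSeries.coeff m (shiftHom d a ha F) =
      MvPowerSeries.coeff m F + ∑ k ∈ range n, t k 0 := by
    rw [coeff_shiftHom d ha _ hm, hn, sum_range_succ', sum_range_succ', map_add, map_sum, add_comm]
    congr 1
    · simp
    · rw [show t 0 0 = 0 from rfl, add_zero]
      refine sum_congr rfl fun k _ => ?_
      rw [ht]
      simp [Function.iterate_succ_apply, ← hD]
  -- On the diagonal `k + r = q` one has a `q`-fold commutator with an operator of order `q - 1`.
  have hsum : ∑ k ∈ range n, ∑ r ∈ range n, t k r = 0 := by
    rw [sum_range_sum_range_eq_sum_antidiagonal]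
    · refine sum_eq_zero fun q _ => ?_
      rcases Nat.eq_zero_or_pos q with rfl | hq
      · simp [ht]
      · rw [sum_congr rfl (g := fun p => MvPowerSeries.coeff m
          (((p.1.factorial : ℚ)⁻¹ * (p.2.factorial : ℚ)⁻¹) •
            ((-a) ^ p.1 * D^[q - 1] (a ^ p.2 * D F)))), ← map_sum,
          sum_antidiagonal_neg_pow_mul_iterate D a (q - 1) q (by omega), map_zero]
        intro p hp
        rw [ht, ← HasAntidiagonal.mem_antidiagonal.1 hp]
        simp only
        rw [if_neg (by rw [HasAntidiagonal.mem_antidiagonal.1 hp]; omega)]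
    · intro i j hij
      rw [ht]
      simp only
      split_ifs
      · rfl
      · rw [coeff_rat_smul, coeff_neg_pow_mul_iterate_eq_zero d ha _ _ _ _ (by omega),
          smul_zero]
  rw [map_add, map_add, hLm, hFm, add_assoc, ← sum_add_distrib]
  conv_rhs => rw [← add_zero (MvPowerSeries.coeff m F), ← hsum]
  congr 1
  refine sum_congr rfl fun k _ => ?_
  rw [hn, sum_range_succ' (fun r => t k r), add_comm]

end Shift

/-! ### Residues: integration by parts and change of variables. -/

section Residue

variable {R : Type*} [CommRing R] [Algebra ℚ R] {τ : Type*} (d : Derivation ℚ R R)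
  {N : Type*} [AddCommGroup N]

/-- Integration by parts: `bʳ (d b) h_r` and `b^{r+1} (d h_r) / (r + 1)` add up to `d (b^{r+1} h_r /
(r + 1))`, which has no residue. -/
theorem res_coeff_mapDerivation_mul_evalAt (res : R →+ N) (hres : ∀ f, res (d f) = 0)
    {b : MvPowerSeries τ R}
    (hb : MvPowerSeries.constantCoeff b = 0) (h : PowerSeries (MvPowerSeries τ R)) {m : τ →₀ ℕ}
    {n : ℕ} (hn : m.degree < n) :
    res (MvPowerSeries.coeff m (mapDerivation d b * evalAt b hb h)) =
      - res (MvPowerSeries.coeff m (∑ r ∈ range n, b ^ (r + 1) *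
          (((r : ℚ) + 1)⁻¹ • mapDerivation d (PowerSeries.coeff r h)))) := by
  rw [coeff_mul_congr (fun _ _ => rfl) (fun p hp => coeff_evalAt hb h hp) hn, mul_sum,
    eq_neg_iff_add_eq_zero, ← map_add, ← map_add, ← sum_add_distrib]
  rw [show ∑ r ∈ range n, (mapDerivation d b * (b ^ r * PowerSeries.coeff r h) +
      b ^ (r + 1) * (((r : ℚ) + 1)⁻¹ • mapDerivation d (PowerSeries.coeff r h))) =
      mapDerivation d (∑ r ∈ range n, ((r : ℚ) + 1)⁻¹ • (b ^ (r + 1) * PowerSeries.coeff r h)) from ?_]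
  · rw [coeff_mapDerivation, hres]
  · rw [map_sum]
    refine sum_congr rfl fun r _ => ?_
    have h1 : ((r : ℚ) + 1) ≠ 0 := by positivity
    rw [Derivation.map_smul, Derivation.leibniz, Derivation.leibniz_pow, Nat.add_sub_cancel,
      smul_add, add_comm]
    congr 1
    · simp
    · rw [← Nat.cast_smul_eq_nsmul ℚ]
      push_cast
      rw [smul_comm (PowerSeries.coeff r h), smul_smul, inv_mul_cancel₀ h1, one_smul, smul_eq_mul,
        smul_eq_mul]
      ring

/-- Change of variables for residues. -/
theorem res_coeff_shiftHom (res : R →+ N) (hres : ∀ f, res (d f) = 0)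
    {a : MvPowerSeries τ R} (ha : MvPowerSeries.constantCoeff a = 0)
    (G : MvPowerSeries τ R) (m : τ →₀ ℕ) :
    res (MvPowerSeries.coeff m ((1 - mapDerivation d a) * shiftHom d a ha G)) =
      res (MvPowerSeries.coeff m G) := by
  have hm : m.degree < m.degree + 1 := m.degree.lt_succ_self
  have ha' : MvPowerSeries.constantCoeff (-a) = 0 := by rw [map_neg, ha, neg_zero]
  have h1 := res_coeff_mapDerivation_mul_evalAt d res hres ha' (expHom (mapDerivation d) G) hm
  rw [sub_mul, one_mul, sub_eq_add_neg, ← neg_mul, ← map_neg, map_add, map_add, shiftHom,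
    RingHom.comp_apply, h1, coeff_evalAt ha' _ (Nat.lt_succ_of_lt hm), sum_range_succ', ← map_neg,
    ← map_neg, ← map_add, ← map_add, add_right_comm, ← sub_eq_add_neg, ← sum_sub_distrib,
    sum_eq_zero]
  · simp [coeff_expHom]
  · intro r _
    rw [coeff_expHom, coeff_expHom, Derivation.map_smul, smul_smul, Function.iterate_succ_apply',
      Nat.factorial_succ]
    push_cast
    rw [mul_inv, sub_self]

theorem res_coeff_evalAt (res : R →+ N) (hres : ∀ f, res (d f) = 0)
    {a : MvPowerSeries τ R} (ha : MvPowerSeries.constantCoeff a = 0)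
    (h : PowerSeries (MvPowerSeries τ R)) {m : τ →₀ ℕ} {n : ℕ} (hn : m.degree < n) :
    res (MvPowerSeries.coeff m ((1 - mapDerivation d a) * evalAt a ha h)) =
      res (MvPowerSeries.coeff m (PowerSeries.coeff 0 h)) +
        ∑ r ∈ range n, res (MvPowerSeries.coeff m (a ^ (r + 1) * (PowerSeries.coeff (r + 1) h +
          ((r : ℚ) + 1)⁻¹ • mapDerivation d (PowerSeries.coeff r h)))) := by
  rw [sub_mul, one_mul, map_sub, map_sub, res_coeff_mapDerivation_mul_evalAt d res hres ha h hn,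
    sub_neg_eq_add, coeff_evalAt ha _ (Nat.lt_succ_of_lt hn), sum_range_succ']
  simp only [map_add, map_sum, mul_add, sum_add_distrib, pow_zero, one_mul]
  abel

end Residue

/-! ### Euler derivations of monoid algebras. -/

section Euler

variable {G : Type*} [AddCommMonoid G]

/-- The Euler derivation of a monoid algebra attached to an additive character `χ`: it multiplies
the coefficient at `g` by `χ g`. -/
def euler (χ : G →+ ℚ) : Derivation ℚ (AddMonoidAlgebra ℚ G) (AddMonoidAlgebra ℚ G) :=
  Derivation.mk'
    { toFun := fun f => AddMonoidAlgebra.ofCoeff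
        (Finsupp.onFinset f.coeff.support (fun g => χ g * f.coeff g) fun g hg => by
          rw [Finsupp.mem_support_iff]
          exact right_ne_zero_of_mul hg)
      map_add' := fun f g => by
        ext x
        simp [mul_add]
      map_smul' := fun q f => by
        ext x
        simp [mul_left_comm] }
    (by
      have single_apply : ∀ (a : G) (q : ℚ), AddMonoidAlgebra.ofCoeff
          (Finsupp.onFinset (AddMonoidAlgebra.single a q).coeff.support
            (fun g => χ g * (AddMonoidAlgebra.single a q).coeff g) fun g hg => by
              rw [Finsupp.mem_support_iff]
              exact right_ne_zero_of_mul hg) = AddMonoidAlgebra.single a (χ a * q) := by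
        classical
        intro a q
        ext x
        simp only [Finsupp.onFinset_apply, AddMonoidAlgebra.coeff_single, Finsupp.single_apply]
        split_ifs with h
        · rw [h]
        · simp
      intro f g
      induction f using AddMonoidAlgebra.induction_linear with
      | zero => rw [zero_mul, map_zero, zero_smul, smul_zero, add_zero]
      | add f₁ f₂ h₁ h₂ => simp only [add_mul, map_add, h₁, h₂, add_smul, smul_add]; abel
      | single a p =>
        induction g using AddMonoidAlgebra.induction_linear with
        | zero => rw [mul_zero, map_zero, zero_smul, smul_zero, add_zero]
        | add g₁ g₂ h₁ h₂ => simp only [mul_add, map_add, h₁, h₂, add_smul, smul_add]; abel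
        | single b q =>
          rw [AddMonoidAlgebra.single_mul_single]
          simp only [LinearMap.coe_mk, AddHom.coe_mk, single_apply, smul_eq_mul,
            AddMonoidAlgebra.single_mul_single]
          rw [add_comm b a, ← AddMonoidAlgebra.single_add]
          congr 1
          rw [map_add]
          ring)

theorem coeff_euler (χ : G →+ ℚ) (f : AddMonoidAlgebra ℚ G) (g : G) :
    (euler χ f).coeff g = χ g * f.coeff g := rfl

theorem euler_single (χ : G →+ ℚ) (a : G) (q : ℚ) :
    euler χ (AddMonoidAlgebra.single a q) = χ a • AddMonoidAlgebra.single a q := by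
  classical
  ext x
  rw [coeff_euler, AddMonoidAlgebra.coeff_smul_apply, AddMonoidAlgebra.coeff_single,
    Finsupp.single_apply]
  split_ifs with h
  · rw [h, smul_eq_mul]
  · simp

end Euler

theorem isUnit_two {R : Type*} [CommRing R] [Algebra ℚ R] : IsUnit (2 : R) := by
  have h := (IsUnit.mk0 (2 : ℚ) two_ne_zero).map (algebraMap ℚ R)
  rwa [map_ofNat] at h

theorem derivation_two_mul {k R : Type*} [CommRing k] [CommRing R] [Algebra k R]
    (d : Derivation k R R) (f : R) : d (2 * f) = 2 * d f := by
  rw [two_mul, map_add, two_mul]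

/-! ### The series `u(s)` and its differential equations. -/

section OneVariable

open LaurentPolynomial (T_add T_pow T_zero)

/-- The variable `y` of the one-variable Laurent polynomial ring. -/
abbrev Y : LaurentPolynomial ℚ := LaurentPolynomial.T 1

/-- The inverse of `Y`. -/
abbrev YInv : LaurentPolynomial ℚ := LaurentPolynomial.T (-1)

theorem Y_mul_YInv : Y * YInv = 1 := (T_add 1 (-1)).symm.trans T_zero

/-- The derivation `(1/y) d/dy` of `ℚ[y^{±1}]`. -/
def dSq : Derivation ℚ (LaurentPolynomial ℚ) (LaurentPolynomial ℚ) :=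
  (LaurentPolynomial.T (-2) : LaurentPolynomial ℚ) • euler (Int.castAddHom ℚ)

theorem dSq_T (n : ℤ) : dSq (LaurentPolynomial.T n) = (n : ℚ) • LaurentPolynomial.T (n - 2) := by
  have h := euler_single (Int.castAddHom ℚ) n 1
  rw [sub_eq_neg_add, T_add, ← mul_smul_comm]
  exact congrArg (LaurentPolynomial.T (-2) * ·) h

theorem dSq_Y : dSq Y = YInv := by
  rw [dSq_T]; simp

theorem dSq_Y_sq : dSq (Y ^ 2) = 2 := by
  rw [T_pow, dSq_T]
  norm_num
  rw [← map_ofNat (algebraMap ℚ (LaurentPolynomial ℚ)) 2, Algebra.algebraMap_eq_smul_one]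

theorem coeff_dSq (f : LaurentPolynomial ℚ) : (dSq f).coeff (-2) = 0 := by
  have h := AddMonoidAlgebra.coeff_single_mul_apply (euler (Int.castAddHom ℚ) f) 1 (-2) (-2)
  change (AddMonoidAlgebra.single (-2) (1 : ℚ) * euler (Int.castAddHom ℚ) f).coeff (-2) = 0
  rw [h, coeff_euler]
  simp

theorem coeff_Y_mul (f : LaurentPolynomial ℚ) (n : ℤ) : (Y * f).coeff n = f.coeff (n - 1) := by
  change (AddMonoidAlgebra.single 1 (1 : ℚ) * f).coeff n = _
  rw [AddMonoidAlgebra.coeff_single_mul_apply, one_mul, neg_add_eq_sub]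

/-- The series `√(y² - 2s)`, the image of `y` under `exp(-s (1/y) d/dy)`. -/
def ySqrt : PowerSeries (LaurentPolynomial ℚ) := PowerSeries.rescale (-1) (expHom dSq Y)

/-- The exponential is multiplicative, and on `y²` it stops after the linear term because `D (y²) =
2` is constant. -/
theorem ySqrt_sq : ySqrt ^ 2 = PowerSeries.C (Y ^ 2) - 2 * PowerSeries.X := by
  rw [ySqrt, ← map_pow, ← map_pow]
  ext1 n
  rw [PowerSeries.coeff_rescale, coeff_expHom, map_sub, PowerSeries.coeff_C,
    ← map_ofNat PowerSeries.C 2, PowerSeries.coeff_C_mul, PowerSeries.coeff_X]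
  match n with
  | 0 => simp
  | 1 => simp only [Function.iterate_one, dSq_Y_sq]; simp
  | n + 2 =>
    rw [Function.iterate_add_apply, Function.iterate_succ_apply, Function.iterate_one, dSq_Y_sq,
      ← map_ofNat (algebraMap ℚ (LaurentPolynomial ℚ)) 2, Derivation.map_algebraMap,
      iterate_map_zero]
    simp

theorem constantCoeff_ySqrt : PowerSeries.constantCoeff ySqrt = Y := by
  rw [ySqrt, ← PowerSeries.coeff_zero_eq_constantCoeff_apply, PowerSeries.coeff_rescale,
    coeff_expHom]
  simp

theorem isUnit_Y : IsUnit Y := .of_mul_eq_one _ Y_mul_YInv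

theorem isUnit_ySqrt : IsUnit ySqrt := by
  rw [PowerSeries.isUnit_iff_constantCoeff, constantCoeff_ySqrt]
  exact isUnit_Y

/-- The series `(y + √(y² - 2s) + s) / 2`. -/
def uSer : PowerSeries (LaurentPolynomial ℚ) :=
  (1 / 2 : ℚ) • (PowerSeries.C Y + ySqrt + PowerSeries.X)

theorem two_mul_uSer : 2 * uSer = PowerSeries.C Y + ySqrt + PowerSeries.X := by
  rw [uSer, mul_smul_comm, two_mul, ← two_smul ℚ, smul_smul]
  norm_num

theorem constantCoeff_uSer : PowerSeries.constantCoeff uSer = Y := by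
  have h := congrArg PowerSeries.constantCoeff two_mul_uSer
  simp only [map_mul, map_add, constantCoeff_ySqrt, PowerSeries.constantCoeff_C,
    PowerSeries.constantCoeff_X, map_ofNat, add_zero] at h
  rw [← two_mul] at h
  exact isUnit_two.mul_left_cancel h

theorem isUnit_uSer : IsUnit uSer := by
  rw [PowerSeries.isUnit_iff_constantCoeff, constantCoeff_uSer]
  exact isUnit_Y

/-- The inverse of `uSer`. -/
def uInv : PowerSeries (LaurentPolynomial ℚ) := ((isUnit_uSer.unit⁻¹ : _ˣ) : PowerSeries _)

theorem uInv_mul_uSer : uInv * uSer = 1 := isUnit_uSer.val_inv_mul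

theorem constantCoeff_uInv : PowerSeries.constantCoeff uInv = YInv := by
  have h := congrArg PowerSeries.constantCoeff uInv_mul_uSer
  rw [map_mul, constantCoeff_uSer, map_one] at h
  calc _ = PowerSeries.constantCoeff uInv * Y * YInv := by rw [mul_assoc, Y_mul_YInv, mul_one]
    _ = _ := by rw [h, one_mul]

local notation "∂s" => PowerSeries.derivative (LaurentPolynomial ℚ)

/-- The derivation `(1/y) d/dy` of `ℚ[y^{±1}]⟦s⟧`. -/
def dSqSer : Derivation ℚ (PowerSeries (LaurentPolynomial ℚ)) (PowerSeries (LaurentPolynomial ℚ)) :=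
  mapDerivation dSq

theorem dSqSer_C (f : LaurentPolynomial ℚ) : dSqSer (PowerSeries.C f) = PowerSeries.C (dSq f) :=
  mapDerivation_C dSq f

theorem coeff_dSqSer (n : ℕ) (F : PowerSeries (LaurentPolynomial ℚ)) :
    PowerSeries.coeff n (dSqSer F) = dSq (PowerSeries.coeff n F) := rfl

theorem dSqSer_X : dSqSer PowerSeries.X = 0 := by
  ext1 n
  rw [coeff_dSqSer, PowerSeries.coeff_X]
  split_ifs <;> simp

theorem ySqrt_mul_derivative : ySqrt * ∂s ySqrt = -1 := by
  have h := congrArg ∂s ySqrt_sq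
  rw [Derivation.leibniz_pow, map_sub, derivation_two_mul, PowerSeries.derivative_C,
    PowerSeries.derivative_X] at h
  simp only [smul_eq_mul, nsmul_eq_mul, pow_one, Nat.cast_ofNat, Nat.add_one_sub_one] at h
  apply isUnit_two.mul_left_cancel
  linear_combination h

theorem ySqrt_mul_dSqSer : ySqrt * dSqSer ySqrt = 1 := by
  have h := congrArg dSqSer ySqrt_sq
  rw [Derivation.leibniz_pow, map_sub, derivation_two_mul, dSqSer_C, dSqSer_X, dSq_Y_sq,
    map_ofNat] at h
  simp only [smul_eq_mul, nsmul_eq_mul, pow_one, Nat.cast_ofNat, Nat.add_one_sub_one] at h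
  apply isUnit_two.mul_left_cancel
  linear_combination h

theorem two_mul_derivative_uSer : 2 * ∂s uSer = ∂s ySqrt + 1 := by
  have h := congrArg ∂s two_mul_uSer
  rwa [derivation_two_mul, map_add, map_add, PowerSeries.derivative_C, PowerSeries.derivative_X,
    zero_add] at h

theorem two_mul_dSqSer_uSer : 2 * dSqSer uSer = PowerSeries.C YInv + dSqSer ySqrt := by
  have h := congrArg dSqSer two_mul_uSer
  rwa [derivation_two_mul, map_add, map_add, dSqSer_C, dSqSer_X, dSq_Y, add_zero] at h

/-- `∂s + D` annihilates `y² - 2s`, hence its square root; only `y` and `s` contribute. -/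
theorem derivative_add_dSqSer_uSer : 2 * (∂s uSer + dSqSer uSer) = PowerSeries.C (1 + YInv) := by
  apply isUnit_ySqrt.mul_left_cancel
  rw [mul_add, two_mul_derivative_uSer, two_mul_dSqSer_uSer, map_add, map_one]
  linear_combination ySqrt_mul_derivative + ySqrt_mul_dSqSer

theorem uSer_pde : 2 * uSer * ∂s uSer + PowerSeries.X * ∂s uSer +
    PowerSeries.C ((1 + Y) * Y) * dSqSer uSer = 2 * uSer := by
  have hY : (PowerSeries.C Y * PowerSeries.C YInv : PowerSeries (LaurentPolynomial ℚ)) = 1 := by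
    rw [← map_mul, Y_mul_YInv, map_one]
  -- Multiplying by `2 √(y² - 2s)` clears the denominators of both derivatives, leaving an identity
  -- modulo `ySqrt_sq`.
  apply isUnit_ySqrt.mul_left_cancel
  apply isUnit_two.mul_left_cancel
  have hsq := ySqrt_sq
  rw [map_pow] at hsq
  rw [map_mul, map_add, map_one, two_mul_uSer]
  linear_combination
    (ySqrt * (PowerSeries.C Y + ySqrt + 2 * PowerSeries.X)) * two_mul_derivative_uSer +
    (ySqrt * (1 + PowerSeries.C Y) * PowerSeries.C Y) * two_mul_dSqSer_uSer +
    (PowerSeries.C Y + ySqrt + 2 * PowerSeries.X) * ySqrt_mul_derivative +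
    ((1 + PowerSeries.C Y) * PowerSeries.C Y) * ySqrt_mul_dSqSer +
    (ySqrt * (1 + PowerSeries.C Y)) * hY - hsq

theorem derivation_uInv_pow {k : Type*} [CommRing k] [Algebra k (PowerSeries (LaurentPolynomial ℚ))]
    (d : Derivation k (PowerSeries (LaurentPolynomial ℚ)) (PowerSeries (LaurentPolynomial ℚ)))
    (n : ℕ) : d (uInv ^ n) = -(n : PowerSeries (LaurentPolynomial ℚ)) * uInv ^ (n + 1) * d uSer := by
  rw [Derivation.leibniz_pow, Derivation.leibniz_of_mul_eq_one d uInv_mul_uSer]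
  cases n with
  | zero => simp
  | succ n =>
    simp only [Nat.add_sub_cancel, smul_eq_mul, nsmul_eq_mul]
    ring

theorem derivative_add_dSqSer_uInv_pow (n : ℕ) :
    2 * (∂s (uInv ^ n) + dSqSer (uInv ^ n)) =
      PowerSeries.C (-(n : LaurentPolynomial ℚ) * (1 + YInv)) * uInv ^ (n + 1) := by
  rw [derivation_uInv_pow, derivation_uInv_pow, map_mul, map_neg, map_natCast]
  linear_combination (-(n : PowerSeries (LaurentPolynomial ℚ)) * uInv ^ (n + 1)) *
    derivative_add_dSqSer_uSer

/-- This is `uSer_pde` times `-(M + 1)(M + 2) u^{-M-3}`; the term `2 u ∂s u` becomes the derivative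
of the lower power `u^{-M-1}`. -/
theorem uInv_pde (M : ℕ) : ((2 * (M + 2) : ℕ) : PowerSeries (LaurentPolynomial ℚ)) *
    ∂s (uInv ^ (M + 1)) + ((M + 1 : ℕ) : PowerSeries (LaurentPolynomial ℚ)) *
      (PowerSeries.X * ∂s (uInv ^ (M + 2)) +
        PowerSeries.C ((1 + Y) * Y) * dSqSer (uInv ^ (M + 2)) +
        ((2 * (M + 2) : ℕ) : PowerSeries (LaurentPolynomial ℚ)) * uInv ^ (M + 2)) = 0 := by
  simp only [derivation_uInv_pow]
  push_cast
  have h := uInv_mul_uSer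
  linear_combination ((M + 1 : PowerSeries (LaurentPolynomial ℚ)) * (M + 2)) * uInv ^ (M + 2) *
    (2 * ∂s uSer - 2) * h - (M + 1 : PowerSeries (LaurentPolynomial ℚ)) * (M + 2) *
      uInv ^ (M + 3) * uSer_pde

/-! ### Vanishing of the residues of powers of `uInv`. -/

/-- The coefficient of `y⁻¹` in `(1 + y)^{2M + 2k + 1} [s^k] uInv^{M + 1}`. -/
def resUInv (k M : ℕ) : ℚ :=
  ((1 + Y) ^ (2 * M + 2 * k + 1) * PowerSeries.coeff k (uInv ^ (M + 1))).coeff (-1)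

/-- Integration by parts: `y D` is `d/dy`, and `(1 + y)^{e+1} f` has a derivative without `y⁻¹`
term. -/
theorem coeff_one_add_Y_pow_mul_dSq (e : ℕ) (f : LaurentPolynomial ℚ) :
    ((1 + Y) ^ e * ((1 + Y) * Y * dSq f)).coeff (-1) =
      -((e + 1 : ℕ) : ℚ) * ((1 + Y) ^ e * f).coeff (-1) := by
  have h := coeff_dSq ((1 + Y) ^ (e + 1) * f)
  rw [show (-2 : ℤ) = -1 - 1 by norm_num, ← coeff_Y_mul, Derivation.leibniz,
    Derivation.leibniz_pow, map_add, dSq_Y, Derivation.map_one_eq_zero, zero_add,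
    Nat.add_sub_cancel] at h
  have h2 : Y * ((1 + Y) ^ (e + 1) • dSq f + f • (e + 1) • (1 + Y) ^ e • YInv) =
      (1 + Y) ^ e * ((1 + Y) * Y * dSq f) + ((e + 1 : ℕ) : ℚ) • ((1 + Y) ^ e * f) := by
    rw [← Nat.cast_smul_eq_nsmul ℚ]
    simp only [smul_eq_mul, Algebra.smul_def, map_natCast]
    linear_combination ((e + 1 : ℕ) * (1 + Y) ^ e * f) * Y_mul_YInv
  rw [h2, AddMonoidAlgebra.coeff_add, Finsupp.add_apply, AddMonoidAlgebra.coeff_smul_apply,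
    smul_eq_mul] at h
  linear_combination h

theorem resUInv_succ (k M : ℕ) :
    2 * (M + 2) * (k + 1) * resUInv (k + 1) M = (M + 1) * k * resUInv k (M + 1) := by
  -- The exponent `2M + 2k + 3` is the one in both residues. The three terms in `u^{-M-2}` then have
  -- total weight `k - (2M + 2k + 4) + 2(M + 2) = -k`.
  have h := congrArg (fun F => ((1 + Y) ^ (2 * M + 2 * k + 3) * PowerSeries.coeff k F).coeff (-1))
    (uInv_pde M)
  have hX : ∀ F : PowerSeries (LaurentPolynomial ℚ), PowerSeries.coeff k (PowerSeries.X * ∂s F) =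
      (k : LaurentPolynomial ℚ) * PowerSeries.coeff k F := by
    intro F
    cases k with
    | zero => simp
    | succ k =>
      rw [PowerSeries.coeff_succ_X_mul, PowerSeries.coeff_derivative]
      push_cast
      ring
  have hn : ∀ (n : ℕ) (F : PowerSeries (LaurentPolynomial ℚ)),
      PowerSeries.coeff k ((n : PowerSeries (LaurentPolynomial ℚ)) * F) =
        (n : ℚ) • PowerSeries.coeff k F := by
    intro n F
    rw [← map_natCast PowerSeries.C, PowerSeries.coeff_C_mul, Algebra.smul_def, map_natCast]
  have hcast : ∀ (n : ℕ) (f : LaurentPolynomial ℚ), (n : LaurentPolynomial ℚ) * f = (n : ℚ) • f := by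
    intro n f
    rw [Algebra.smul_def, map_natCast]
  simp only [map_add, hn, hX, PowerSeries.coeff_C_mul, PowerSeries.coeff_derivative, coeff_dSqSer,
    map_zero, mul_zero, AddMonoidAlgebra.coeff_zero, Finsupp.zero_apply] at h
  rw [mul_comm (PowerSeries.coeff (k + 1) _), ← Nat.cast_add_one] at h
  simp only [hcast, mul_add, mul_smul_comm, AddMonoidAlgebra.coeff_add, Finsupp.add_apply,
    AddMonoidAlgebra.coeff_smul_apply, smul_eq_mul, coeff_one_add_Y_pow_mul_dSq] at h
  rw [resUInv, resUInv, show 2 * M + 2 * (k + 1) + 1 = 2 * M + 2 * k + 3 by ring,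
    show 2 * (M + 1) + 2 * k + 1 = 2 * M + 2 * k + 3 by ring, show M + 1 + 1 = M + 2 by ring]
  push_cast at h
  linear_combination h

/-- The factor `k` on the right of `resUInv_succ` kills the case `k = 0`; the recurrence propagates
this to all larger `k`. -/
theorem resUInv_eq_zero (k M : ℕ) : resUInv (k + 1) M = 0 := by
  induction k generalizing M with
  | zero =>
    have h := resUInv_succ 0 M
    simp only [Nat.cast_zero, mul_zero, zero_mul, zero_add, mul_one] at h
    exact (mul_eq_zero.1 h).resolve_left (by positivity)
  | succ k ih =>
    have h := resUInv_succ (k + 1) M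
    rw [ih, mul_zero] at h
    exact (mul_eq_zero.1 h).resolve_left (by positivity)

theorem resUInv_zero (M : ℕ) : resUInv 0 M = (2 * M + 1).choose M := by
  have hterm : ∀ k ∈ range (2 * M + 1 + 1), (Y ^ k * 1 ^ (2 * M + 1 - k) *
      ((2 * M + 1).choose k : LaurentPolynomial ℚ) *
        LaurentPolynomial.T (((M + 1 : ℕ) : ℤ) * -1)).coeff (-1) =
      if k = M then ((2 * M + 1).choose k : ℚ) else 0 := by
    intro k _
    rw [T_pow, one_pow, mul_one, mul_right_comm, ← T_add, mul_comm, ← map_natCast (algebraMap ℚ _),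
      ← Algebra.smul_def, AddMonoidAlgebra.coeff_smul_apply, LaurentPolynomial.T_apply,
      smul_eq_mul, mul_ite, mul_zero, mul_one]
    refine if_congr ?_ (mul_one _) rfl
    push_cast
    omega
  rw [resUInv, PowerSeries.coeff_zero_eq_constantCoeff_apply, map_pow, constantCoeff_uInv, T_pow,
    add_comm (1 : LaurentPolynomial ℚ), add_pow, sum_mul, AddMonoidAlgebra.coeff_sum,
    Finsupp.finsetSum_apply, mul_zero, add_zero, sum_congr rfl hterm, sum_ite_eq',
    if_pos (by rw [mem_range]; omega)]

end OneVariable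

/-! ### Two-variable Laurent polynomials. -/

section Laurent

/-- The derivation `(1/y) d/dy` of `ℚ[v^{±1}, y^{±1}]`. -/
def dLaurent : Derivation ℚ Laurent Laurent :=
  mono 0 (-2) • euler ((Int.castAddHom ℚ).comp (AddMonoidHom.snd ℤ ℤ))

theorem ddy_add (f g : Laurent) : ddy (f + g) = ddy f + ddy g :=
  Finsupp.sum_add_index' (by simp) (by simp [mul_add, AddMonoidAlgebra.single_add])

theorem dLaurent_single (p : ℤ × ℤ) (q : ℚ) :
    dLaurent (AddMonoidAlgebra.single p q) =
      AddMonoidAlgebra.single (p.1, p.2 - 2) ((p.2 : ℚ) * q) := by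
  have h := euler_single ((Int.castAddHom ℚ).comp (AddMonoidHom.snd ℤ ℤ)) p q
  refine (congrArg (mono 0 (-2) * ·) h).trans ?_
  simp only [mono]
  rw [AddMonoidAlgebra.smul_single, AddMonoidAlgebra.single_mul_single, smul_eq_mul]
  congr 1
  · exact Prod.ext (zero_add _) (neg_add_eq_sub _ _)
  · exact one_mul _

theorem yInv_mul_ddy (f : Laurent) : yInv * ddy f = dLaurent f := by
  induction f using AddMonoidAlgebra.induction_linear with
  | zero => simp [ddy]
  | add f g hf hg => rw [ddy_add, mul_add, hf, hg, map_add]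
  | single p q =>
    rw [dLaurent_single, ddy, AddMonoidAlgebra.coeff_single, Finsupp.sum_single_index (by simp),
      yInv, mono, AddMonoidAlgebra.single_mul_single, one_mul, Prod.mk_add_mk, zero_add]
    congr 2
    ring

theorem iterate_yInvDdy {σ : Type*} (n : ℕ) (F : MvPowerSeries σ Laurent) :
    yInvDdy^[n] F = (mapDerivation dLaurent)^[n] F := by
  congr 1
  funext F
  ext1 m
  exact yInv_mul_ddy _

/-- The inclusion of the Laurent polynomials in `y` into those in `v` and `y`. -/
def ofY : LaurentPolynomial ℚ →ₐ[ℚ] Laurent :=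
  AddMonoidAlgebra.mapDomainAlgHom ℚ ℚ (AddMonoidHom.inr ℤ ℤ)

theorem ofY_single (n : ℤ) (q : ℚ) :
    ofY (AddMonoidAlgebra.single n q) = AddMonoidAlgebra.single (0, n) q :=
  AddMonoidAlgebra.mapDomain_single

theorem ofY_T (n : ℤ) : ofY (LaurentPolynomial.T n) = mono 0 n := ofY_single n 1

theorem ofY_dSq (f : LaurentPolynomial ℚ) : ofY (dSq f) = dLaurent (ofY f) := by
  induction f using AddMonoidAlgebra.induction_linear with
  | zero => simp
  | add f g hf hg => simp only [map_add, hf, hg]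
  | single n q =>
    rw [ofY_single, dLaurent_single]
    have h : (AddMonoidAlgebra.single n q : LaurentPolynomial ℚ) = q • LaurentPolynomial.T n := by
      rw [LaurentPolynomial.T, AddMonoidAlgebra.smul_single, smul_eq_mul, mul_one]
    rw [h, Derivation.map_smul, dSq_T, map_smul, map_smul, ofY_T, mono,
      AddMonoidAlgebra.smul_single, AddMonoidAlgebra.smul_single]
    congr 1
    simp [mul_comm]

theorem coeff_mono_mul_ofY (i i' j : ℤ) (f : LaurentPolynomial ℚ) :
    (mono i 0 * ofY f).coeff (i', j) = if i = i' then f.coeff j else 0 := by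
  induction f using AddMonoidAlgebra.induction_linear with
  | zero => simp
  | add f g hf hg =>
    rw [map_add, mul_add, AddMonoidAlgebra.coeff_add, Finsupp.add_apply, hf, hg]
    split_ifs <;> simp
  | single n q =>
    rw [ofY_single, mono, AddMonoidAlgebra.single_mul_single, one_mul, Prod.mk_add_mk, add_zero,
      zero_add, AddMonoidAlgebra.coeff_single, AddMonoidAlgebra.coeff_single, Finsupp.single_apply,
      Finsupp.single_apply]
    by_cases h : i = i' <;> simp [h]

theorem mono_mul (i j i' j' : ℤ) : mono i j * mono i' j' = mono (i + i') (j + j') := by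
  rw [mono, mono, AddMonoidAlgebra.single_mul_single, one_mul]
  rfl

theorem mono_pow (i : ℤ) (n : ℕ) : mono i 0 ^ n = mono (n * i) 0 := by
  induction n with
  | zero => rw [pow_zero, Nat.cast_zero, zero_mul]; rfl
  | succ n ih =>
    rw [pow_succ, ih, mono_mul, add_zero]
    congr 1
    push_cast
    ring

theorem ofY_Y : ofY Y = y := ofY_T 1

theorem ofY_YInv : ofY YInv = yInv := ofY_T (-1)

/-- The coefficient functional `[v^i y^{-2}]`. -/
def resAt (i : ℤ) : Laurent →+ ℚ where
  toFun f := f.coeff (i, -2)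
  map_zero' := rfl
  map_add' _ _ := rfl

theorem resAt_dLaurent (i : ℤ) (f : Laurent) : resAt i (dLaurent f) = 0 := by
  have h := AddMonoidAlgebra.coeff_single_mul_apply
    (euler ((Int.castAddHom ℚ).comp (AddMonoidHom.snd ℤ ℤ)) f) 1 (0, -2) (i, -2)
  refine h.trans ?_
  rw [coeff_euler]
  simp

/-- In `v^{-r} (v (1 + y)²)^k` the power of `v` determines `k`, so only `k = n + r` is seen. -/
theorem resAt_vInv_pow_mul (n r : ℕ) (p : Polynomial ℚ) (q : LaurentPolynomial ℚ) :
    resAt n (vInv ^ r * Polynomial.aeval (v * (1 + y) ^ 2) p * ofY q) =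
      p.coeff (n + r) * ((1 + Y) ^ (2 * (n + r)) * q).coeff (-2) := by
  induction p using Polynomial.induction_on' with
  | add f g hf hg => simp only [map_add, mul_add, add_mul, hf, hg, Polynomial.coeff_add]
  | monomial k c =>
    have h : vInv ^ r * Polynomial.aeval (v * (1 + y) ^ 2) (Polynomial.monomial k c) * ofY q =
        mono (k - r) 0 * ofY (c • ((1 + Y) ^ (2 * k) * q)) := by
      have hv : vInv ^ r * v ^ k = mono (k - r) 0 := by
        rw [vInv, v, mono_pow, mono_pow, mono_mul, add_zero]
        congr 1
        ring
      rw [Polynomial.aeval_monomial, map_smul, map_mul, map_pow, map_add, map_one, ofY_Y, ← hv,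
        Algebra.smul_def, mul_pow, ← pow_mul]
      ring
    rw [h]
    refine (coeff_mono_mul_ofY _ _ _ _).trans ?_
    rw [Polynomial.coeff_monomial, AddMonoidAlgebra.coeff_smul_apply, smul_eq_mul, ite_mul,
      zero_mul]
    by_cases hk : k = n + r
    · rw [if_pos hk, if_pos (by omega), hk]
    · rw [if_neg hk, if_neg (by omega)]

end Laurent

/-! ### The shift of `T` and the extraction of the coefficient. -/

section Main

variable {σ : Type*} (c : ℕ → MvPowerSeries σ ℚ)

theorem constantCoeff_A (h0 : ∀ a, MvPowerSeries.constantCoeff (c a) = 0) :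
    MvPowerSeries.constantCoeff (A c) = 0 := by
  change vInv * ∑ᶠ a : ℕ, MvPowerSeries.constantCoeff (c a) • (v * (1 + y) ^ 2) ^ a = 0
  simp [h0]

theorem exists_coeff_A_eq (m : σ →₀ ℕ)
    (hfin : {a : ℕ | MvPowerSeries.coeff m (c a) ≠ 0}.Finite) :
    ∃ p : Polynomial ℚ, (∀ a, p.coeff a = MvPowerSeries.coeff m (c a)) ∧
      MvPowerSeries.coeff m (A c) = vInv * Polynomial.aeval (v * (1 + y) ^ 2) p := by
  refine ⟨∑ a ∈ hfin.toFinset, Polynomial.monomial a (MvPowerSeries.coeff m (c a)), ?_, ?_⟩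
  · intro a
    simp only [Polynomial.finsetSum_coeff, Polynomial.coeff_monomial]
    rw [sum_ite_eq']
    simp +contextual [eq_comm]
  · change vInv * ∑ᶠ a : ℕ, MvPowerSeries.coeff m (c a) • (v * (1 + y) ^ 2) ^ a = _
    rw [map_sum, finsum_eq_sum_of_support_subset (s := hfin.toFinset)]
    · simp only [Polynomial.aeval_monomial, Algebra.smul_def]
    · intro a ha
      rw [Set.Finite.coe_toFinset]
      exact fun h => ha (by simp [h])

theorem exists_coeff_A_pow_eq
    (hfin : ∀ m : σ →₀ ℕ, {a : ℕ | MvPowerSeries.coeff m (c a) ≠ 0}.Finite) (r : ℕ) (m : σ →₀ ℕ) :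
    ∃ p : Polynomial ℚ,
      MvPowerSeries.coeff m (A c ^ r) = vInv ^ r * Polynomial.aeval (v * (1 + y) ^ 2) p := by
  classical
  induction r generalizing m with
  | zero =>
    refine ⟨if m = 0 then 1 else 0, ?_⟩
    rw [pow_zero, pow_zero, MvPowerSeries.coeff_one, one_mul]
    split_ifs <;> simp
  | succ r ih =>
    choose p hp using ih
    choose q _ hq using fun m => exists_coeff_A_eq c m (hfin m)
    refine ⟨∑ x ∈ antidiagonal m, p x.1 * q x.2, ?_⟩
    rw [pow_succ, MvPowerSeries.coeff_mul, map_sum, mul_sum]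
    refine sum_congr rfl fun x _ => ?_
    rw [hp, hq, map_mul]
    ring

variable {a : MvPowerSeries σ Laurent} (ha : MvPowerSeries.constantCoeff a = 0)

/-- The inclusion of the Laurent polynomials in `y` as constant power series. -/
def constY : LaurentPolynomial ℚ →+* MvPowerSeries σ Laurent :=
  MvPowerSeries.C.comp (ofY : LaurentPolynomial ℚ →+* Laurent)

theorem constY_apply (f : LaurentPolynomial ℚ) :
    (constY f : MvPowerSeries σ Laurent) = MvPowerSeries.C (ofY f) := rfl

theorem mapDerivation_constY (f : LaurentPolynomial ℚ) :
    mapDerivation dLaurent (constY f : MvPowerSeries σ Laurent) = constY (dSq f) := by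
  rw [constY_apply, mapDerivation_C, constY_apply, ofY_dSq]

theorem iterate_mapDerivation_constY (k : ℕ) (f : LaurentPolynomial ℚ) :
    (mapDerivation dLaurent)^[k] (constY f : MvPowerSeries σ Laurent) = constY (dSq^[k] f) := by
  induction k generalizing f with
  | zero => rfl
  | succ k ih =>
    rw [Function.iterate_succ_apply, mapDerivation_constY, ih, Function.iterate_succ_apply]

theorem constY_smul (q : ℚ) (f : LaurentPolynomial ℚ) :
    (constY (q • f) : MvPowerSeries σ Laurent) = q • constY f := by
  classical
  ext1 m
  rw [coeff_rat_smul, constY_apply, constY_apply, MvPowerSeries.coeff_C, MvPowerSeries.coeff_C,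
    map_smul]
  split_ifs <;> simp

/-- Substitution of `a` for the variable of a power series over `ℚ[y^{±1}]`. -/
def substHom (ha : MvPowerSeries.constantCoeff a = 0) :
    PowerSeries (LaurentPolynomial ℚ) →+* MvPowerSeries σ Laurent :=
  (evalAt a ha).comp (PowerSeries.map constY)

theorem substHom_C (f : LaurentPolynomial ℚ) : substHom ha (PowerSeries.C f) = constY f := by
  ext1 m
  rw [substHom, RingHom.comp_apply, PowerSeries.map_C, coeff_evalAt ha _ m.degree.lt_succ_self,
    sum_range_succ', sum_eq_zero]
  · simp
  · intro r _
    simp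

/-- The shift expands in powers of `-a`, the substitution in powers of `a`; `rescale (-1)` absorbs
the sign. -/
theorem shiftHom_constY (f : LaurentPolynomial ℚ) :
    shiftHom dLaurent a ha (constY f) = substHom ha (PowerSeries.rescale (-1) (expHom dSq f)) := by
  ext1 m
  rw [substHom, RingHom.comp_apply, coeff_shiftHom _ _ _ m.degree.lt_succ_self,
    coeff_evalAt ha _ m.degree.lt_succ_self]
  congr 1
  refine sum_congr rfl fun k _ => ?_
  rw [PowerSeries.coeff_map, PowerSeries.coeff_rescale, coeff_expHom, map_mul, map_pow, map_neg,
    map_one]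
  rw [iterate_mapDerivation_constY, constY_smul, ← mul_smul_comm, neg_pow]
  ring

theorem shiftHom_T (h0 : ∀ a, MvPowerSeries.constantCoeff (c a) = 0) :
    shiftHom dLaurent (A c) (constantCoeff_A c h0) (T c + MvPowerSeries.C y) =
      substHom (constantCoeff_A c h0) (2 * uSer) := by
  set ha := constantCoeff_A c h0
  -- A primitive of `(1 + y)/y` for `D`, so that `T - y` is the Lagrange series of `f`.
  set f : LaurentPolynomial ℚ := Y + (1 / 2 : ℚ) • Y ^ 2 with hf
  have hdf : dSq f = (1 + Y) * YInv := by
    rw [hf, map_add, Derivation.map_smul, dSq_Y, dSq_Y_sq, add_mul, one_mul, Y_mul_YInv,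
      ← map_ofNat (algebraMap ℚ (LaurentPolynomial ℚ)) 2, Algebra.smul_def, ← map_mul]
    norm_num
  have hL := shiftHom_lagrange dLaurent ha (constY f) (T c - MvPowerSeries.C y) (by
    intro m
    rw [map_sub]
    change MvPowerSeries.coeff m (MvPowerSeries.C y) +
      ∑ r ∈ Icc 1 m.degree, MvPowerSeries.coeff m (term c r) - _ = _
    rw [add_sub_cancel_left]
    refine sum_congr rfl fun r _ => ?_
    rw [term, iterate_yInvDdy, mapDerivation_constY, hdf, constY_apply, map_mul ofY, map_add ofY,
      map_one ofY, ofY_Y, ofY_YInv, mul_comm (A c ^ r)])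
  have hy : (MvPowerSeries.C y : MvPowerSeries σ Laurent) = constY Y := by
    rw [constY_apply, ofY_Y]
  have hS : shiftHom dLaurent (A c) ha (T c + MvPowerSeries.C y) =
      shiftHom dLaurent (A c) ha (constY f + (T c - MvPowerSeries.C y)) -
        shiftHom dLaurent (A c) ha (constY f) + 2 * shiftHom dLaurent (A c) ha (constY Y) := by
    rw [← map_sub, two_mul, ← map_add, ← map_add, hy]
    congr 1
    ring
  rw [hS, hL, shiftHom_constY, shiftHom_constY, ← substHom_C ha, ← map_sub,
    ← map_ofNat (substHom ha) 2, ← map_mul, ← map_add, two_mul_uSer]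
  congr 1
  apply isUnit_two.mul_left_cancel
  have h2 : 2 * f = 2 * Y + Y ^ 2 := by
    rw [hf, mul_add, mul_smul_comm, two_mul (Y ^ 2), ← two_smul ℚ, smul_smul]
    norm_num
  have h3 := congrArg (PowerSeries.C (R := LaurentPolynomial ℚ)) h2
  have h4 := congrArg (fun g => PowerSeries.rescale (-1) (expHom dSq g)) h2
  have h5 := ySqrt_sq
  simp only [map_mul, map_add, map_pow, map_ofNat] at h3 h4 h5
  rw [← ySqrt] at h4 ⊢
  linear_combination h3 - h4 - h5

theorem constantCoeff_T : MvPowerSeries.constantCoeff (T c) = y := by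
  change MvPowerSeries.coeff 0 (MvPowerSeries.C y) +
    ∑ r ∈ Icc 1 (0 : σ →₀ ℕ).degree, MvPowerSeries.coeff 0 (term c r) = y
  simp

theorem isUnit_half_smul_T_add :
    IsUnit ((1 / 2 : ℚ) • (T c + MvPowerSeries.C y)) := by
  rw [MvPowerSeries.isUnit_iff_constantCoeff]
  have h : MvPowerSeries.constantCoeff ((1 / 2 : ℚ) • (T c + MvPowerSeries.C y)) = y := by
    rw [← MvPowerSeries.coeff_zero_eq_constantCoeff_apply, coeff_rat_smul,
      MvPowerSeries.coeff_zero_eq_constantCoeff_apply, map_add, constantCoeff_T, MvPowerSeries.constantCoeff_C, ← two_smul ℚ, smul_smul]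
    norm_num
  rw [h, ← ofY_Y]
  exact isUnit_Y.map ofY

/-- The bracket is `[s^r] (∂s + D) u^{-N} / (r + 1)`. The factor `1 + y⁻¹ = (1 + y)/y` this produces
raises the exponent of `1 + y` by one and moves `y⁻²` to `y⁻¹`. -/
theorem coeff_succ_add_smul_dSq (N r : ℕ) :
    ((1 + Y) ^ (2 * (N + r)) * (PowerSeries.coeff (r + 1) (uInv ^ N) +
      ((r : ℚ) + 1)⁻¹ • dSq (PowerSeries.coeff r (uInv ^ N)))).coeff (-2) =
        -(N / (2 * (r + 1)) : ℚ) * resUInv r N := by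
  have h1 : ((r : ℚ) + 1) ≠ 0 := by positivity
  have h := congrArg (PowerSeries.coeff r) (derivative_add_dSqSer_uInv_pow N)
  rw [← map_ofNat PowerSeries.C 2, PowerSeries.coeff_C_mul, PowerSeries.coeff_C_mul, map_add,
    PowerSeries.coeff_derivative, coeff_dSqSer] at h
  set q := PowerSeries.coeff (r + 1) (uInv ^ N) +
    ((r : ℚ) + 1)⁻¹ • dSq (PowerSeries.coeff r (uInv ^ N)) with hq
  have hq2 : (2 * ((r : ℚ) + 1)) • q =
      -(N : LaurentPolynomial ℚ) * (1 + YInv) * PowerSeries.coeff r (uInv ^ (N + 1)) := by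
    rw [← h, hq, mul_smul, smul_add, smul_smul, mul_inv_cancel₀ h1, one_smul]
    simp only [Algebra.smul_def, map_add, map_natCast, map_one, map_ofNat]
    ring
  have hY : Y * (1 + YInv) = 1 + Y := by
    rw [mul_add, Y_mul_YInv, mul_one, add_comm]
  have hq3 : (2 * ((r : ℚ) + 1)) • (Y * ((1 + Y) ^ (2 * (N + r)) * q)) =
      (-(N : ℚ)) • ((1 + Y) ^ (2 * N + 2 * r + 1) * PowerSeries.coeff r (uInv ^ (N + 1))) := by
    rw [← mul_smul_comm, ← mul_smul_comm, hq2, Algebra.smul_def, map_neg, map_natCast,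
      pow_succ (1 + Y)]
    linear_combination (-(N : LaurentPolynomial ℚ)) * (1 + Y) ^ (2 * N + 2 * r) *
      PowerSeries.coeff r (uInv ^ (N + 1)) * hY
  have h4 := congrArg (fun f : LaurentPolynomial ℚ => f.coeff (-1)) hq3
  simp only [AddMonoidAlgebra.coeff_smul_apply, coeff_Y_mul, smul_eq_mul] at h4
  rw [show (-2 : ℤ) = -1 - 1 by norm_num, resUInv]
  field_simp
  linear_combination h4

theorem coeffVY_inv_pow (h0 : ∀ a, MvPowerSeries.constantCoeff (c a) = 0)
    (hfin : ∀ m : σ →₀ ℕ, {a : ℕ | MvPowerSeries.coeff m (c a) ≠ 0}.Finite)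
    (U : (MvPowerSeries σ Laurent)ˣ)
    (hU : (U : MvPowerSeries σ Laurent) = (1 / 2 : ℚ) • (T c + MvPowerSeries.C y))
    (n : ℕ) (m : σ →₀ ℕ) :
    resAt n (MvPowerSeries.coeff m ((U⁻¹ : (MvPowerSeries σ Laurent)ˣ) ^ (n + 1) :
      MvPowerSeries σ Laurent)) =
      -((n + 1 : ℚ) / 2) * (2 * (n + 1) + 1).choose (n + 1) * MvPowerSeries.coeff m (c (n + 1)) := by
  classical
  set ha := constantCoeff_A c h0
  have hSU : shiftHom dLaurent (A c) ha U = substHom ha uSer := by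
    apply isUnit_two.mul_left_cancel
    have h2U : 2 * (U : MvPowerSeries σ Laurent) = T c + MvPowerSeries.C y := by
      rw [hU, mul_smul_comm, two_mul, ← two_smul ℚ, smul_smul]
      norm_num
    rw [← map_ofNat (shiftHom dLaurent (A c) ha) 2, ← map_mul, h2U, shiftHom_T c h0, map_mul, map_ofNat,
      map_ofNat]
  have hSinv : shiftHom dLaurent (A c) ha ((U⁻¹ : (MvPowerSeries σ Laurent)ˣ) :
      MvPowerSeries σ Laurent) = substHom ha uInv := by
    apply (U.isUnit.map (shiftHom dLaurent (A c) ha)).mul_left_cancel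
    rw [← map_mul, U.mul_inv, map_one, hSU, ← map_mul, mul_comm, uInv_mul_uSer, map_one]
  rw [← res_coeff_shiftHom dLaurent (resAt n) (resAt_dLaurent n) ha, map_pow, hSinv, ← map_pow,
    substHom, RingHom.comp_apply,
    res_coeff_evalAt dLaurent (resAt n) (resAt_dLaurent n) ha _ m.degree.lt_succ_self]
  -- The constant term in `s` is `y^{-n-1}`: it is free of `v`, and for `n = 0` it is `y⁻¹` rather
  -- than `y⁻²`.
  have hfirst : resAt n (MvPowerSeries.coeff m (PowerSeries.coeff 0
      (PowerSeries.map (constY (σ := σ)) (uInv ^ (n + 1))))) = 0 := by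
    rw [PowerSeries.coeff_map, constY_apply, MvPowerSeries.coeff_C]
    split_ifs
    · have h := coeff_mono_mul_ofY 0 n (-2) (PowerSeries.coeff 0 (uInv ^ (n + 1)))
      rw [show mono 0 0 = 1 from rfl, one_mul] at h
      refine h.trans ?_
      split_ifs with hn
      · rw [PowerSeries.coeff_zero_eq_constantCoeff_apply, map_pow, constantCoeff_uInv,
          LaurentPolynomial.T_pow, LaurentPolynomial.T_apply, if_neg (by push_cast; omega)]
      · rfl
    · exact map_zero _
  have hterm : ∀ (r : ℕ) (p : Polynomial ℚ), MvPowerSeries.coeff m (A c ^ (r + 1)) =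
      vInv ^ (r + 1) * Polynomial.aeval (v * (1 + y) ^ 2) p →
      resAt n (MvPowerSeries.coeff m (A c ^ (r + 1) *
        (PowerSeries.coeff (r + 1) (PowerSeries.map constY (uInv ^ (n + 1))) +
          ((r : ℚ) + 1)⁻¹ • mapDerivation dLaurent
            (PowerSeries.coeff r (PowerSeries.map constY (uInv ^ (n + 1))))))) =
      p.coeff (n + 1 + r) * (-(((n + 1 : ℕ) : ℚ) / (2 * (r + 1))) * resUInv r (n + 1)) := by
    intro r p hp
    rw [PowerSeries.coeff_map, PowerSeries.coeff_map, mapDerivation_constY, ← constY_smul, ← map_add,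
      constY_apply, MvPowerSeries.coeff_mul_C, hp, resAt_vInv_pow_mul,
      show n + (r + 1) = n + 1 + r by ring, coeff_succ_add_smul_dSq]
  rw [hfirst, zero_add, sum_range_succ', sum_eq_zero, zero_add]
  · obtain ⟨p, hpc, hp⟩ := exists_coeff_A_eq c m (hfin m)
    rw [hterm 0 p (by rw [zero_add, pow_one, pow_one, hp]), add_zero, hpc, resUInv_zero]
    push_cast
    ring
  · intro r _
    -- For higher powers of `A` the coefficients of `p` are irrelevant, since they multiply a
    -- vanishing residue.
    obtain ⟨p, hp⟩ := exists_coeff_A_pow_eq c hfin (r + 1 + 1) m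
    rw [hterm (r + 1) p hp, resUInv_eq_zero, mul_zero, mul_zero]

end Main

end CuriousIdentity

end

theorem theorem2 {σ : Type*} (c : ℕ → MvPowerSeries σ ℚ)
    (hc_inf : ∀ a, MvPowerSeries.constantCoeff (c a) = 0)
    (hc_fin : ∀ m : σ →₀ ℕ, {a : ℕ | MvPowerSeries.coeff m (c a) ≠ 0}.Finite) :
    ∃ U : (MvPowerSeries σ CuriousIdentity.Laurent)ˣ,
      (U : MvPowerSeries σ CuriousIdentity.Laurent) =
        (1 / 2 : ℚ) • (CuriousIdentity.T c + MvPowerSeries.C CuriousIdentity.y) ∧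
      ∀ N : ℕ, 1 ≤ N →
        CuriousIdentity.coeffVY ((N : ℤ) - 1) (-2)
            ((U ^ (-(N : ℤ)) : (MvPowerSeries σ CuriousIdentity.Laurent)ˣ) :
              MvPowerSeries σ CuriousIdentity.Laurent) =
          (-(1 / 4 : ℚ) * (N : ℚ) * ((2 * N + 2).choose (N + 1) : ℚ)) • c N := by
  obtain ⟨U, hU⟩ := CuriousIdentity.isUnit_half_smul_T_add c
  refine ⟨U, hU, fun N hN => ?_⟩
  obtain ⟨n, rfl⟩ : ∃ n, N = n + 1 := ⟨N - 1, by omega⟩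
  ext m
  have h := CuriousIdentity.coeffVY_inv_pow c hc_inf hc_fin U hU n m
  -- The central binomial coefficient is twice its neighbour in the row above, which turns the
  -- factor `1/2` into `1/4`.
  have hchoose : (2 * (n + 1) + 2).choose (n + 1 + 1) =
      2 * (2 * (n + 1) + 1).choose (n + 1) := by
    rw [Nat.choose_succ_succ, Nat.choose_symm_half, ← two_mul]
  rw [zpow_neg, zpow_natCast, ← inv_pow, Units.val_pow_eq_pow_val, hchoose]
  push_cast
  rw [add_sub_cancel_right]
  refine h.trans ?_
  rw [CuriousIdentity.coeff_rat_smul, smul_eq_mul]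
  ring
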